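/- Smoothness between locally convex spaces is understood in the sense of iterated directional derivatives: a map $f\colon U\to F$ on an open subset $U$ of a locally convex space $E$ is smooth if it is continuous, all iterated directional derivatives $(\partial_{h_j}\cdots\partial_{h_1}f)(x)$ exist and, for every $j$, the map $U\times E^j\to F$, $(x,h_1,\dots,h_j)\mapsto(\partial_{h_j}\cdots\partial_{h_1}f)(x)$, is continuous. All locally convex spaces are real and Hausdorff. Let $G$ be a Lie group modeled on a locally convex space (a group which is a smooth manifold modeled on a locally convex space, with smooth multiplication and inversion), with Lie algebra $\mathfrak g=T_{\mathbf 1}(G)$. Suppose that $G$ has the Trotter property, i.e., $G$ has a smooth exponential function $\exp_G\colon\mathfrak g\to G$ (a smooth map such that each $\gamma_x(t)=\exp_G(tx)$, $x\in\mathfrak g$, is a one-parameter group with $\gamma_x'(0)=x$), and for all $x_1,x_2\in\mathfrak g$ $$\exp_G(t(x_1+x_2))=\lim_{n\to\infty}\Big(\exp_G\big(\tfrac tn x_1\big)\exp_G\big(\tfrac tn x_2\big)\Big)^n$$ holds uniformly for $t$ in compact subsets of $\mathbb R$. Let $V$ be a locally convex space and $\pi\colon G\to \mathrm{GL}(V)$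 a representation that is continuous in the sense that the action $G\times V\to V$, $(g,v)\mapsto\pi(g)v$, is continuous. For $x\in\mathfrak g$ let $\mathcal D_x$ be the set of all $v\in V$ for which $$\overline{\mathrm d\pi}(x)v:=\frac{d}{dt}\Big|_{t=0}\pi(\exp_G(tx))v$$ exists, and let $\mathcal D^1:=\bigcap_{x\in\mathfrak g}\mathcal D_x$. Then, for each $v\in\mathcal D^1$, the map $$\omega_v\colon\mathfrak g\to V,\qquad x\mapsto\overline{\mathrm d\pi}(x)v,$$ is linear. -/

import Mathlib

open Filter Topology Set

namespace LCLie

/-! ### Differential calculus in locally convex spaces -/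

section Calculus

variable {E F : Type*} [AddCommGroup E] [Module ℝ E] [AddCommGroup F] [Module ℝ F]
  [TopologicalSpace F]

/-- `w` is the directional derivative of `f` at `x` in the direction `h`:
`w = lim_{t → 0} t⁻¹ (f (x + t h) - f x)`. -/
def HasDirDerivAt (f : E → F) (x h : E) (w : F) : Prop :=
  Tendsto (fun t : ℝ => t⁻¹ • (f (x + t • h) - f x)) (𝓝[≠] 0) (𝓝 w)

/-- `w` is the derivative at `0` of the curve `γ`. -/
def HasDerivAtZero (γ : ℝ → F) (w : F) : Prop :=
  Tendsto (fun t : ℝ => t⁻¹ • (γ t - γ 0)) (𝓝[≠] 0) (𝓝 w)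

/-- `f` is smooth on the open set `U`: all iterated directional derivatives
`D j x (h₁, …, hⱼ) = (∂_{hⱼ} ⋯ ∂_{h₁} f) x` exist for `x ∈ U`, and every
`D j : U × E ^ j → F` is continuous. For `j = 0` this says that `f` is continuous on `U`.
(Only used for open `U` and Hausdorff `F`, where the values of `D j` on `U` are determined
by `f`.) -/
def SmoothOn [TopologicalSpace E] (f : E → F) (U : Set E) : Prop :=
  ∃ D : (j : ℕ) → E → (Fin j → E) → F,
    (∀ x ∈ U, ∀ h : Fin 0 → E, D 0 x h = f x) ∧
    (∀ j : ℕ, ∀ x ∈ U, ∀ (h : Fin j → E) (k : E),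
      HasDirDerivAt (fun y => D j y h) x k (D (j + 1) x (Fin.snoc h k))) ∧
    (∀ j : ℕ, ContinuousOn (fun p : E × (Fin j → E) => D j p.1 p.2) (U ×ˢ univ))

end Calculus

/-! ### Locally convex manifolds and Lie groups -/

section Manifold

/-- The local representative `e' ∘ f ∘ e⁻¹` of `f : M → N` with respect to the charts `e` and `e'`
is smooth where it is defined. (Only used for continuous `f`, so that this set is open.) -/
def SmoothInCharts {M N E F : Type*} [TopologicalSpace M] [TopologicalSpace N]
    [AddCommGroup E] [Module ℝ E] [TopologicalSpace E]
    [AddCommGroup F] [Module ℝ F] [TopologicalSpace F]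
    (e : OpenPartialHomeomorph M E) (e' : OpenPartialHomeomorph N F) (f : M → N) : Prop :=
  SmoothOn (fun x => e' (f (e.symm x))) (e.target ∩ {x | f (e.symm x) ∈ e'.source})

variable (E : Type*) [AddCommGroup E] [Module ℝ E] [TopologicalSpace E]
  (G : Type*) [Group G] [TopologicalSpace G] [ChartedSpace E G]

/-- `G`, with the charts of its given atlas, is a Lie group modeled on the locally convex space
`E`: the transition maps are smooth, and so are multiplication and inversion. -/
structure IsLieGroup : Prop where
  smooth_transition : ∀ e ∈ atlas E G, ∀ e' ∈ atlas E G, SmoothInCharts e e' (id : G → G)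
  continuous_mul : Continuous fun p : G × G => p.1 * p.2
  smooth_mul : ∀ e₁ ∈ atlas E G, ∀ e₂ ∈ atlas E G, ∀ e' ∈ atlas E G,
    SmoothInCharts (e₁.prod e₂) e' fun p : G × G => p.1 * p.2
  continuous_inv : Continuous fun g : G => g⁻¹
  smooth_inv : ∀ e ∈ atlas E G, ∀ e' ∈ atlas E G, SmoothInCharts e e' fun g : G => g⁻¹

/-- The locally convex space underlying the Lie algebra `𝔤 = T_1 G`. As for Mathlib's
`TangentSpace`, a tangent vector at `1` is represented by its coordinates in the preferred chart
`chartAt E 1`, so the velocity at `0` of a curve `γ` through `1` is `(chartAt E 1 ∘ γ)'(0)`. -/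
@[nolint unusedArguments]
abbrev LieAlg (E : Type*) [AddCommGroup E] [Module ℝ E] [TopologicalSpace E]
    (G : Type*) [Group G] [TopologicalSpace G] [ChartedSpace E G] : Type _ := E

variable {E G}

/-- `exp : 𝔤 → G` is a (smooth) exponential function of `G`: it is a smooth map, and each curve
`γ_x t = exp (t x)` is a one-parameter group with `γ_x' 0 = x`. -/
structure IsExponential (exp : LieAlg E G → G) : Prop where
  continuous : Continuous exp
  smooth : ∀ e ∈ atlas E G, SmoothInCharts (OpenPartialHomeomorph.refl E) e exp
  map_add_smul : ∀ (x : LieAlg E G) (s t : ℝ), exp ((s + t) • x) = exp (s • x) * exp (t • x)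
  velocity : ∀ x : LieAlg E G,
    HasDerivAtZero (fun t : ℝ => chartAt E (1 : G) (exp (t • x))) x

/-- The Trotter property of a Lie group with exponential function `exp`: for all `x₁, x₂ ∈ 𝔤`,
`(exp (t/n x₁) exp (t/n x₂)) ^ n → exp (t (x₁ + x₂))` as `n → ∞`, uniformly for `t` in compact
subsets of `ℝ`, that is, for every neighborhood `U` of `1` the `n`-th term eventually lies in
`exp (t (x₁ + x₂)) U` for all `t` in the compact set. -/
def TrotterProperty (exp : LieAlg E G → G) : Prop :=
  ∀ x₁ x₂ : LieAlg E G, ∀ K : Set ℝ, IsCompact K → ∀ U ∈ 𝓝 (1 : G),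
    ∀ᶠ n : ℕ in atTop, ∀ t ∈ K,
      (exp (t • (x₁ + x₂)))⁻¹ * (exp ((t / n) • x₁) * exp ((t / n) • x₂)) ^ n ∈ U

end Manifold

/-! ### Representations -/

section Representation

variable {E : Type*} [AddCommGroup E] [Module ℝ E] [TopologicalSpace E]
  {G : Type*} [Group G] [TopologicalSpace G] [ChartedSpace E G]
  {V : Type*} [AddCommGroup V] [Module ℝ V] [TopologicalSpace V]

/-- The representation `π` is continuous: the action `(g, v) ↦ π(g) v` is jointly continuous. -/
def IsContinuousRep (π : Representation ℝ G V) : Prop :=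
  Continuous fun p : G × V => π p.1 p.2

/-- The domain `𝓓_x` of the infinitesimal generator of `t ↦ π(exp (t x))`. -/
def generatorDomain (π : Representation ℝ G V) (exp : LieAlg E G → G) (x : LieAlg E G) : Set V :=
  {v | ∃ w : V, HasDerivAtZero (fun t : ℝ => π (exp (t • x)) v) w}

/-- The common domain `𝓓¹` of all these generators. -/
def commonDomain (π : Representation ℝ G V) (exp : LieAlg E G → G) : Set V :=
  ⋂ x : LieAlg E G, generatorDomain π exp x

/-- The infinitesimal generator `v ↦ d/dt|_{t=0} π(exp (t x)) v`; the value is meaningful for `v`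
in `generatorDomain π exp x`. -/
noncomputable def generator (π : Representation ℝ G V) (exp : LieAlg E G → G)
    (x : LieAlg E G) (v : V) : V :=
  haveI : Nonempty V := ⟨0⟩
  limUnder (𝓝[≠] (0 : ℝ)) fun t : ℝ => t⁻¹ • (π (exp (t • x)) v - π (exp ((0 : ℝ) • x)) v)

end Representation

end LCLie

/-!
The generators are homogeneous in `x` by rescaling time, so the point is additivity. Fix
`v ∈ 𝓓¹` and `x, y ∈ 𝔤`, and put `F h = exp (h x) exp (h y)`. The product rule shows that
`h ↦ π (F h) v` has the derivative `w = dπ(x) v + dπ(y) v` at `0`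
(`hasDerivAtZero_product`). Telescoping,
`t⁻¹ (π (F (t/n) ^ n) v - v)` is the average over `k < n` of the vectors
`π (F (t/n) ^ k) uₙ`, where `uₙ = (t/n)⁻¹ (π (F (t/n)) v - v) → w`.

By the Trotter property, used uniformly in time, all the powers `F (t/n) ^ k` with `k < n` are
close to `1` when `t` is small and `n` is large (`exists_forall_pow_mem`): the `k`-th power is the
`k`-th Trotter approximation at time `t k / n`. Hence by continuity of the action all averaged
vectors lie in a given convex neighborhood of `w`, and so does their average. Letting `n → ∞`, the
Trotter formula at the fixed time `t` puts `t⁻¹ (π (exp (t (x + y))) v - v)` in the closure of that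
neighborhood, for all small `t ≠ 0`. So `w` is the derivative of `t ↦ π (exp (t (x + y))) v`
(`hasDerivAtZero_trotter`).
-/

namespace LCLie

theorem sum_range_pow_apply_sub {G V : Type*} [Group G] [AddCommGroup V] [Module ℝ V]
    (π : Representation ℝ G V) (g : G) (v : V) (n : ℕ) :
    ∑ k ∈ Finset.range n, π (g ^ k) (π g v - v) = π (g ^ n) v - v := by
  simpa [pow_succ] using Finset.sum_range_sub (fun k => π (g ^ k) v) n

section Generator

variable {E : Type*} [AddCommGroup E] [Module ℝ E] [TopologicalSpace E]
  {G : Type*} [Group G] [TopologicalSpace G] [ChartedSpace E G]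
  {V : Type*} [AddCommGroup V] [Module ℝ V] [TopologicalSpace V]

theorem IsExponential.map_zero {exp : LieAlg E G → G} (hexp : IsExponential exp) :
    exp 0 = 1 := by
  have h := hexp.map_add_smul 0 0 0
  simp only [smul_zero] at h
  exact left_eq_mul.mp h

theorem generator_eq [T2Space V] {π : Representation ℝ G V} {exp : LieAlg E G → G}
    {x : LieAlg E G} {v w : V} (h : HasDerivAtZero (fun t : ℝ => π (exp (t • x)) v) w) :
    generator π exp x v = w :=
  Tendsto.limUnder_eq h

theorem hasDerivAtZero_generator [T2Space V] {π : Representation ℝ G V} {exp : LieAlg E G → G}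
    {v : V} (hv : v ∈ commonDomain π exp) (x : LieAlg E G) :
    HasDerivAtZero (fun t : ℝ => π (exp (t • x)) v) (generator π exp x v) := by
  obtain ⟨w, hw⟩ := mem_iInter.mp hv x
  rwa [generator_eq hw]

theorem HasDerivAtZero.comp_mul_left [ContinuousSMul ℝ V] {γ : ℝ → V} {w : V}
    (h : HasDerivAtZero γ w) (c : ℝ) : HasDerivAtZero (fun t => γ (t * c)) (c • w) := by
  unfold HasDerivAtZero at *
  rcases eq_or_ne c 0 with rfl | hc
  · simpa using tendsto_const_nhds
  have hlim : Tendsto (fun t : ℝ => t * c) (𝓝[≠] 0) (𝓝[≠] 0) := by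
    refine tendsto_nhdsWithin_iff.mpr ⟨?_, ?_⟩
    · have : Continuous fun t : ℝ => t * c := by fun_prop
      simpa using (this.tendsto 0).mono_left nhdsWithin_le_nhds
    · filter_upwards [self_mem_nhdsWithin] with t ht using mul_ne_zero ht hc
  refine ((h.comp hlim).const_smul c).congr fun t => ?_
  simp only [Function.comp, smul_smul, zero_mul]
  congr 1
  rw [mul_inv, mul_comm, mul_assoc, inv_mul_cancel₀ hc, mul_one]

/-- The product rule at `0` for `h ↦ π (a h) (π (b h) v)`, where `a` is merely continuous at `0`
as a curve in `G`. -/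
theorem hasDerivAtZero_product [ContinuousAdd V] {π : Representation ℝ G V}
    (hπ : IsContinuousRep π) {a b : ℝ → G} (ha : Tendsto a (𝓝 0) (𝓝 1)) (ha0 : a 0 = 1)
    (hb0 : b 0 = 1) {v w₁ w₂ : V} (h₁ : HasDerivAtZero (fun t => π (a t) v) w₁)
    (h₂ : HasDerivAtZero (fun t => π (b t) v) w₂) :
    HasDerivAtZero (fun t => π (a t * b t) v) (w₁ + w₂) := by
  unfold HasDerivAtZero at *
  have hact : Tendsto (fun p : G × V => π p.1 p.2) (𝓝 (1, w₂)) (𝓝 w₂) := by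
    simpa using (show Continuous fun p : G × V => π p.1 p.2 from hπ).tendsto (1, w₂)
  have h₃ := hact.comp ((ha.mono_left nhdsWithin_le_nhds).prodMk_nhds h₂)
  refine (h₁.add h₃).congr fun t => ?_
  simp only [Function.comp, ha0, hb0, map_mul, mul_one, map_one, Module.End.mul_apply,
    Module.End.one_apply, map_smul, map_sub]
  rw [← smul_add]
  congr 1
  abel

/-- For small `t` and large `n`, all powers of `exp (t/n x) exp (t/n y)` with exponent below `n`
are close to `1`. -/
theorem exists_forall_pow_mem [ContinuousSMul ℝ E] [ContinuousMul G] {exp : LieAlg E G → G}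
    (hexp : IsExponential exp) (htrotter : TrotterProperty exp) (x y : LieAlg E G)
    {U : Set G} (hU : U ∈ 𝓝 1) :
    ∃ δ > 0, ∀ t : ℝ, |t| ≤ δ → ∀ᶠ n : ℕ in atTop, ∀ k < n,
      (exp ((t / n) • x) * exp ((t / n) • y)) ^ k ∈ U := by
  obtain ⟨U₁, hU₁, hmul⟩ := exists_nhds_one_split hU
  have hcont (z : LieAlg E G) : Continuous fun s : ℝ => exp (s • z) :=
    hexp.continuous.comp (continuous_id.smul continuous_const)
  have hexpU : ∀ᶠ s : ℝ in 𝓝 0, exp (s • (x + y)) ∈ U₁ := by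
    refine (hcont (x + y)).tendsto 0 ?_
    rwa [zero_smul, hexp.map_zero]
  obtain ⟨δ, hδ, hball⟩ := Metric.nhds_basis_closedBall.mem_iff.mp hexpU
  refine ⟨δ, hδ, fun t ht => ?_⟩
  obtain ⟨N, hN⟩ := eventually_atTop.mp
    (htrotter x y _ (isCompact_closedBall (0 : ℝ) δ) U₁ hU₁)
  have hsmall : ∀ᶠ n : ℕ in atTop, ∀ k ∈ Finset.range (N + 1),
      (exp ((t / n) • x) * exp ((t / n) • y)) ^ k ∈ U := by
    refine (Finset.eventually_all _).mpr fun k _ => ?_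
    have hlim : Tendsto (fun s : ℝ => (exp (s • x) * exp (s • y)) ^ k) (𝓝 0) (𝓝 1) := by
      have : Continuous fun s : ℝ => (exp (s • x) * exp (s • y)) ^ k :=
        ((hcont x).mul (hcont y)).pow k
      simpa [hexp.map_zero] using this.tendsto 0
    exact (hlim.comp (tendsto_const_div_atTop_nhds_zero_nat t)) hU
  filter_upwards [hsmall] with n hn k hk
  rcases Nat.lt_or_ge k (N + 1) with hkN | hkN
  · exact hn k (Finset.mem_range.mpr hkN)
  -- `F (t / n) ^ k` is the `k`-th Trotter approximation at the time `s = t k / n`.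
  have hk0 : (0 : ℝ) < k := by exact_mod_cast (by omega : 0 < k)
  have hn0 : (0 : ℝ) < n := by exact_mod_cast (by omega : 0 < n)
  have hkn : (k : ℝ) ≤ n := by exact_mod_cast hk.le
  set s : ℝ := t * (k / n) with hs
  have hsk : s / k = t / n := by rw [hs]; field_simp
  have hsδ : s ∈ Metric.closedBall (0 : ℝ) δ := by
    rw [mem_closedBall_zero_iff, Real.norm_eq_abs, hs, abs_mul, abs_of_pos (div_pos hk0 hn0)]
    exact (mul_le_of_le_one_right (abs_nonneg t) ((div_le_one hn0).mpr hkn)).trans ht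
  have h₂ := hN k (by omega) s hsδ
  rw [hsk] at h₂
  simpa using hmul _ (hball hsδ) _ h₂

/-- The derivative at `0` of `h ↦ π (exp (h x) exp (h y)) v` is also that of
`t ↦ π (exp (t (x + y))) v`. -/
theorem hasDerivAtZero_trotter [ContinuousSMul ℝ E] [ContinuousMul G]
    [IsTopologicalAddGroup V] [ContinuousSMul ℝ V] [LocallyConvexSpace ℝ V]
    {exp : LieAlg E G → G} (hexp : IsExponential exp) (htrotter : TrotterProperty exp)
    {π : Representation ℝ G V} (hπ : IsContinuousRep π) {x y : LieAlg E G} {v w : V}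
    (h : HasDerivAtZero (fun t : ℝ => π (exp (t • x) * exp (t • y)) v) w) :
    HasDerivAtZero (fun t : ℝ => π (exp (t • (x + y))) v) w := by
  have hact : Continuous fun p : G × V => π p.1 p.2 := hπ
  unfold HasDerivAtZero at *
  simp only [zero_smul, hexp.map_zero, mul_one, map_one, Module.End.one_apply] at h ⊢
  refine (closed_nhds_basis w).tendsto_right_iff.mpr fun C hC => ?_
  obtain ⟨W, ⟨hW, hWconv⟩, hWC⟩ :=
    (LocallyConvexSpace.convex_basis (𝕜 := ℝ) w).mem_iff.mp hC.1
  obtain ⟨U, hU, O, hO, hUO⟩ : ∃ U ∈ 𝓝 (1 : G), ∃ O ∈ 𝓝 w, U ×ˢ O ⊆ {p | π p.1 p.2 ∈ W} := by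
    refine mem_nhds_prod_iff.mp (hact.tendsto (1, w) ?_)
    simpa using hW
  obtain ⟨δ, hδ, hpow⟩ := exists_forall_pow_mem hexp htrotter x y hU
  filter_upwards [self_mem_nhdsWithin,
    nhdsWithin_le_nhds (Metric.closedBall_mem_nhds (0 : ℝ) hδ)] with t ht0 htδ
  have ht0 : t ≠ 0 := ht0
  rw [mem_closedBall_zero_iff, Real.norm_eq_abs] at htδ
  have hpowlim : Tendsto (fun n : ℕ => (exp ((t / n) • x) * exp ((t / n) • y)) ^ n) atTop
      (𝓝 (exp (t • (x + y)))) := by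
    have h₁ : Tendsto (fun n : ℕ => (exp (t • (x + y)))⁻¹ *
        (exp ((t / n) • x) * exp ((t / n) • y)) ^ n) atTop (𝓝 1) := fun S hS =>
      (htrotter x y {t} isCompact_singleton S hS).mono fun n hn => hn t rfl
    simpa using h₁.const_mul (exp (t • (x + y)))
  have hlim : Tendsto
      (fun n : ℕ => t⁻¹ • (π ((exp ((t / n) • x) * exp ((t / n) • y)) ^ n) v - v)) atTop
      (𝓝 (t⁻¹ • (π (exp (t • (x + y))) v - v))) :=
    (((hact.comp (Continuous.prodMk_left v)).tendsto _).comp hpowlim |>.sub_const v).const_smul _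
  refine closure_minimal hWC hC.2 (mem_closure_of_tendsto hlim ?_)
  have hdiv : Tendsto (fun n : ℕ => t / n) atTop (𝓝[≠] 0) :=
    tendsto_nhdsWithin_iff.mpr ⟨tendsto_const_div_atTop_nhds_zero_nat t,
      (eventually_gt_atTop 0).mono fun n hn => div_ne_zero ht0 (by exact_mod_cast hn.ne')⟩
  filter_upwards [hpow t htδ, hdiv.eventually (h hO), eventually_gt_atTop 0] with n hn hu hn0
  have hn0' : (n : ℝ) ≠ 0 := by exact_mod_cast hn0.ne'
  -- Each summand of the telescoping sum, rescaled, lies in the convex set `W`.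
  have hmem := hWconv.sum_mem (t := Finset.range n) (w := fun _ => (n : ℝ)⁻¹)
    (fun _ _ => by positivity) (by simp [hn0'])
    (fun k hk => hUO (mk_mem_prod (hn k (Finset.mem_range.mp hk)) hu))
  change t⁻¹ • _ ∈ W
  convert hmem using 1
  rw [← sum_range_pow_apply_sub, Finset.smul_sum]
  refine Finset.sum_congr rfl fun k _ => ?_
  rw [map_smul, smul_smul]
  congr 1
  field_simp

end Generator

end LCLie

theorem mainTheorem2
    {E : Type*} [AddCommGroup E] [Module ℝ E] [TopologicalSpace E] [IsTopologicalAddGroup E]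
    [ContinuousSMul ℝ E] [LocallyConvexSpace ℝ E] [T2Space E]
    {G : Type*} [Group G] [TopologicalSpace G] [ChartedSpace E G]
    (hG : LCLie.IsLieGroup E G)
    (exp : LCLie.LieAlg E G → G) (hexp : LCLie.IsExponential exp)
    (htrotter : LCLie.TrotterProperty exp)
    {V : Type*} [AddCommGroup V] [Module ℝ V] [TopologicalSpace V] [IsTopologicalAddGroup V]
    [ContinuousSMul ℝ V] [LocallyConvexSpace ℝ V] [T2Space V]
    (π : Representation ℝ G V) (hπ : LCLie.IsContinuousRep π)
    (v : V) (hv : v ∈ LCLie.commonDomain π exp) :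
    IsLinearMap ℝ (fun x : LCLie.LieAlg E G => LCLie.generator π exp x v) := by
  have : ContinuousMul G := ⟨hG.continuous_mul⟩
  have hgen := LCLie.hasDerivAtZero_generator hv
  refine ⟨fun x y => LCLie.generator_eq ?_, fun c x => LCLie.generator_eq ?_⟩
  · have hcont : Continuous fun t : ℝ => exp (t • x) :=
      hexp.continuous.comp (continuous_id.smul continuous_const)
    refine LCLie.hasDerivAtZero_trotter hexp htrotter hπ
      (LCLie.hasDerivAtZero_product hπ ?_ ?_ ?_ (hgen x) (hgen y))
    · simpa [hexp.map_zero] using hcont.tendsto 0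
    · simp [hexp.map_zero]
    · simp [hexp.map_zero]
  · simpa only [smul_smul] using (hgen x).comp_mul_left c
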